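/- For a partition $\pi$ (a finite non-increasing sequence of positive integers) let $|\pi|$ be the sum of its parts, $\nu_d(\pi)$ the number of different parts of $\pi$, and $f_i=f_i(\pi)$ the number of times $i$ occurs as a part of $\pi$. Write $\chi(A)=1$ if the assertion $A$ is true and $\chi(A)=0$ otherwise. Let $\tilde C$ be the set of all non-empty partitions with no part divisible by $3$. Let $\mathcal R$ be the set of partitions $\pi$ for which there is an integer $n>0$ such that 1. all parts of $\pi$ are $\le 2n-1$; 2. all positive even integers $\le 2n-2$ appear as parts of $\pi$; 3. $f_n\ge 1+\chi(n\text{ is even})$; 4. no even part greater than $n$ repeats. This $n$ is determined by $\pi$: $n=n(\pi)=\frac12(\text{largest even part of }\pi)+1$, where the largest even part is taken to be $0$ if $\pi$ has no even part. For $\pi\in\mathcal R$ and $n=n(\pi)$ define \[ \delta(\pi)=\sum_{j=1}^{n-1}\chi(f_{2j}>1),\qquad \gamma(\pi)=\bigl(\chi(n\text{ is even})+2 f_n\,\chi(n\text{ is odd})\bigr)\prod_{\substack{j\ge 0\\ 2j+1<n}}(2f_{2j+1}+1),\qquad \mu(\pi)=2^{\delta(\pi)}\gamma(\pi). \] Then,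 as formal power series in $q$, \[ \sum_{\pi\in\tilde C}2^{\nu_d(\pi)}q^{|\pi|}=\sum_{\pi\in\mathcal R}\mu(\pi)\,q^{|\pi|}. \] -/

import Mathlib

namespace WeightedPartitions

/-- The frequency `f_i` of the part `i` in the partition `π`. -/
def freq {N : ℕ} (π : N.Partition) (i : ℕ) : ℕ := π.parts.count i

/-- `ν_d(π)`: the number of different parts of `π`. -/
def numDistinctParts {N : ℕ} (π : N.Partition) : ℕ := π.parts.toFinset.card

/-- The generating function `∑ w(π) q^{|π|}` over all partitions `π` in a class `S`, as a formal
power series: the coefficient of `q^N` is the sum of `w(π)` over the finitely many partitions `π`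
of `N` that lie in `S`. A partition is a pair of its norm `N` and a partition of `N`. -/
noncomputable def genFun (S : Set (Σ N : ℕ, N.Partition)) (w : (Σ N : ℕ, N.Partition) → ℕ) :
    PowerSeries ℤ :=
  open Classical in
  PowerSeries.mk fun N => ∑ π : N.Partition, if ⟨N, π⟩ ∈ S then (w ⟨N, π⟩ : ℤ) else 0

/-- The set of all non-empty partitions with no part divisible by 3. -/
def setC : Set (Σ N : ℕ, N.Partition) :=
  {p | p.2.parts ≠ 0 ∧ ∀ i ∈ p.2.parts, ¬ 3 ∣ i}

/-- The set `R` of partitions `π` such that for some integer `n > 0`: all parts are `≤ 2n - 1`,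
all positive even integers `≤ 2n - 2` are parts, `f_n ≥ 1 + χ(n is even)`, and no even part
greater than `n` repeats. (The bounds are written without subtraction.) -/
def setR : Set (Σ N : ℕ, N.Partition) :=
  {p | ∃ n : ℕ, 0 < n ∧
    (∀ i ∈ p.2.parts, i + 1 ≤ 2 * n) ∧
    (∀ i : ℕ, 0 < i → Even i → i + 2 ≤ 2 * n → i ∈ p.2.parts) ∧
    1 + (if Even n then 1 else 0) ≤ freq p.2 n ∧
    (∀ i ∈ p.2.parts, Even i → n < i → freq p.2 i = 1)}

/-- `n(π) = (largest even part of π) / 2 + 1`, where the largest even part is read as `0` if `π`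
has no even part. -/
def nStat {N : ℕ} (π : N.Partition) : ℕ := (π.parts.filter Even).sup / 2 + 1

/-- `δ(π) = ∑_{j=1}^{n-1} χ(f_{2j} > 1)` with `n = n(π)`. -/
def delta {N : ℕ} (π : N.Partition) : ℕ :=
  ∑ j ∈ Finset.Ico 1 (nStat π), if 1 < freq π (2 * j) then 1 else 0

/-- `γ(π) = (χ(n even) + 2 f_n χ(n odd)) ∏_{2j+1 < n} (2 f_{2j+1} + 1)` with `n = n(π)`,
the product being over all integers `j ≥ 0` with `2j + 1 < n`. -/
def gamma {N : ℕ} (π : N.Partition) : ℕ :=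
  ((if Even (nStat π) then 1 else 0) +
      2 * freq π (nStat π) * (if Odd (nStat π) then 1 else 0)) *
    ∏ j ∈ (Finset.range (nStat π)).filter (fun j => 2 * j + 1 < nStat π),
      (2 * freq π (2 * j + 1) + 1)

/-- `μ(π) = 2^{δ(π)} γ(π)`. -/
def mu {N : ℕ} (π : N.Partition) : ℕ := 2 ^ delta π * gamma π

end WeightedPartitions

/-! A part `i` not divisible by 3 contributes `(1 + q^i) / (1 - q^i)` to the left side, which is
thus the product of these factors minus 1. On the right, fixing `n(π) = n` turns `μ` into a product
of weights of single parts, and this class has the series `q^(n²) β_n` with `β_n = (-1; q)_n (-q;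
q)_n / (q; q)_{2n}` (`prod_partSeries_partWeight`). Since `β_0 = 1`, it remains to show that `∑_{n ≥
0} q^(n²) β_n` equals the product.

Both are compared with `S = ∑_r q^(r(3r-1)/2)`. The finite Jacobi triple product at `z = 1` expands
`β_n` as `∑_r q^(r(r-1)/2) / ((q)_{n-r} (q)_{n+r})`. Summing over `n` by a case of Bailey's lemma
(`sum_pow_sq_mul_invPochInt`, from `q`-Chu–Vandermonde) multiplies the `r`-th term by `q^(r²)`, and
the limit is `S / (q; q)_∞`. The same finite identity in base `q³` at `z = q` gives `∏ (1 +
q^(3i+1)) (1 + q^(3i+2)) = S / (q³; q³)_∞`. Sorting the factors of `(q; q)_∞` modulo 3 identifies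
the two. Limits are handled by finite identities modulo `X ^ (M + 1)`. -/

open Finset PowerSeries

namespace WeightedPartitions

/-! ### Gaussian binomials and `q`-Chu–Vandermonde. -/

section QBinomial

variable {R : Type*} [CommRing R]

/-- The Gaussian binomial coefficient, defined through the `q`-Pascal recursion. -/
def qBinom (q : R) : ℕ → ℕ → R
  | _, 0 => 1
  | 0, _ + 1 => 0
  | m + 1, k + 1 => qBinom q m k + q ^ (k + 1) * qBinom q m (k + 1)

@[simp]
theorem qBinom_zero_right (q : R) (m : ℕ) : qBinom q m 0 = 1 := by
  cases m <;> rfl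

theorem qBinom_succ_succ (q : R) (m k : ℕ) :
    qBinom q (m + 1) (k + 1) = qBinom q m k + q ^ (k + 1) * qBinom q m (k + 1) := rfl

theorem qBinom_eq_zero_of_lt (q : R) {m k : ℕ} (h : m < k) : qBinom q m k = 0 := by
  induction m generalizing k with
  | zero => obtain ⟨k, rfl⟩ := Nat.exists_eq_succ_of_ne_zero h.ne'; rfl
  | succ m ih =>
    obtain ⟨k, rfl⟩ := Nat.exists_eq_succ_of_ne_zero (Nat.ne_zero_of_lt h)
    rw [Nat.succ_eq_add_one, qBinom_succ_succ, ih (by omega), ih (by omega)]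
    simp

/-- The `q`-binomial theorem in homogeneous form. -/
theorem prod_add_mul_pow (q x y : R) (m : ℕ) :
    ∏ i ∈ range m, (y + x * q ^ i) =
      ∑ k ∈ range (m + 1), q ^ k.choose 2 * x ^ k * y ^ (m - k) * qBinom q m k := by
  induction m generalizing x with
  | zero => simp
  | succ m ih =>
    have hsplit : ∏ i ∈ range (m + 1), (y + x * q ^ i) =
        (y + x) * ∏ i ∈ range m, (y + (x * q) * q ^ i) := by
      rw [prod_range_succ', mul_comm]
      congr 1
      · simp
      · exact prod_congr rfl fun i _ => by ring
    have hy : ∑ k ∈ range (m + 1), y * (q ^ k.choose 2 * (x * q) ^ k * y ^ (m - k) * qBinom q m k)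
        = y ^ (m + 1) + ∑ k ∈ range (m + 1), q ^ (k + 1).choose 2 * x ^ (k + 1) * y ^ (m - k) *
            (q ^ (k + 1) * qBinom q m (k + 1)) := by
      rw [sum_range_succ' _ m, sum_range_succ _ m, qBinom_eq_zero_of_lt q (Nat.lt_succ_self m),
        add_comm]
      simp only [Nat.choose_zero_succ, pow_zero, Nat.sub_zero, qBinom_zero_right, mul_one, one_mul,
        mul_zero, add_zero]
      congr 1
      · ring
      · refine sum_congr rfl fun k hk => ?_
        have : m - k = m - (k + 1) + 1 := by have := mem_range.1 hk; omega
        rw [this]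
        ring
    rw [hsplit, ih, add_mul, mul_sum, mul_sum, hy, sum_range_succ' _ (m + 1), add_assoc,
      add_comm]
    congr 1
    · rw [← sum_add_distrib]
      refine sum_congr rfl fun k _ => ?_
      rw [qBinom_succ_succ, Nat.add_sub_add_right, Nat.choose_succ_succ' k 1, Nat.choose_one_right]
      ring
    · simp

variable {q : R} {e : ℕ → R}

/-- Here and below `e k` plays the role of `1 / (q; q)_k`, so this is the quotient formula for
Gaussian binomials. Induction uses `1 - q^(m+1) = (1 - q^(k+1)) + (q^(k+1) - q^(m+1))`, matched with
the two terms of Pascal's rule. -/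
theorem qBinom_mul (he0 : e 0 = 1) (he : ∀ k, (1 - q ^ (k + 1)) * e (k + 1) = e k)
    (hq : ∀ k, IsUnit (1 - q ^ (k + 1))) (k l : ℕ) :
    qBinom q (k + l) k * e (k + l) = e k * e l := by
  induction hm : k + l generalizing k l with
  | zero =>
    obtain ⟨rfl, rfl⟩ : k = 0 ∧ l = 0 := by omega
    simp [he0]
  | succ m ih =>
    cases k with
    | zero => simp [he0, ← hm]
    | succ k =>
      apply (hq m).mul_left_cancel
      have h1 := ih k l (by omega)
      have h2 : q ^ (k + 1) * qBinom q m (k + 1) * e m =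
          (q ^ (k + 1) - q ^ (m + 1)) * (e (k + 1) * e l) := by
        cases l with
        | zero =>
          have : m = k := by omega
          subst this
          simp [qBinom_eq_zero_of_lt]
        | succ l =>
          have hml : m + 1 = (k + 1) + (l + 1) := by omega
          rw [mul_assoc, ih (k + 1) l (by omega), ← he l, hml]
          ring
      rw [qBinom_succ_succ]
      linear_combination h1 + h2 + (qBinom q m k + q ^ (k + 1) * qBinom q m (k + 1)) * he m +
        e l * (-he k)

/-- A form of the `q`-Chu–Vandermonde identity. -/
theorem sum_qBinom_mul (he : ∀ k, (1 - q ^ (k + 1)) * e (k + 1) = e k) (s d : ℕ) :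
    ∑ m ∈ range (s + 1), q ^ (m * (m + d)) * qBinom q s m * e (m + d) = e (s + d) := by
  induction s generalizing d with
  | zero => simp
  | succ s ih =>
    rw [show s + 1 + d = s + (d + 1) by ring, ← ih (d + 1), sum_range_succ' _ (s + 1)]
    simp only [qBinom_succ_succ]
    have hA : ∑ m ∈ range (s + 1), q ^ (m * (m + d)) * (q ^ m * qBinom q s m) * e (m + d) =
        ∑ m ∈ range (s + 1), q ^ ((m + 1) * (m + 1 + d)) * (q ^ (m + 1) * qBinom q s (m + 1)) *
          e (m + 1 + d) + q ^ (0 * (0 + d)) * qBinom q (s + 1) 0 * e (0 + d) := by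
      rw [sum_range_succ' _ s, sum_range_succ _ s, qBinom_eq_zero_of_lt q (Nat.lt_succ_self s)]
      simp
    simp only [mul_add, add_mul, sum_add_distrib] at hA ⊢
    rw [add_assoc, ← hA, ← sum_add_distrib]
    refine sum_congr rfl fun m _ => ?_
    -- Expanding `e (m + d) = (1 - q^(m+d+1)) e (m+d+1)`, the negative part cancels the first Pascal
    -- term, as `m(m+d+1) + (m+d+1) = (m+1)(m+1+d)`.
    rw [← he (m + d)]
    ring_nf

theorem sum_pow_mul_mul (he0 : e 0 = 1) (he : ∀ k, (1 - q ^ (k + 1)) * e (k + 1) = e k)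
    (hq : ∀ k, IsUnit (1 - q ^ (k + 1))) (s d : ℕ) :
    ∑ m ∈ range (s + 1), q ^ (m * (m + d)) * (e (s - m) * e m * e (m + d)) =
      e s * e (s + d) := by
  rw [← sum_qBinom_mul he s d, mul_sum]
  refine sum_congr rfl fun m hm => ?_
  have h := qBinom_mul he0 he hq m (s - m)
  rw [Nat.add_sub_cancel' (by have := mem_range.1 hm; omega)] at h
  linear_combination (- q ^ (m * (m + d)) * e (m + d)) * h

end QBinomial

/-! ### Finite Jacobi triple product. -/

/-- `r (r - 1) / 2` as a natural number. -/
def triInt (r : ℤ) : ℕ := (r * (r - 1) / 2).toNat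

theorem two_mul_triInt (r : ℤ) : 2 * (triInt r : ℤ) = r * (r - 1) := by
  have h2 : (2 : ℤ) ∣ r * (r - 1) := by
    have := Int.even_mul_pred_self r
    exact this.two_dvd
  have h0 : 0 ≤ r * (r - 1) := by
    rcases le_or_gt r 0 with h | h <;> nlinarith
  rw [triInt, Int.toNat_of_nonneg (by omega)]
  omega

/-- The finite form of the Jacobi triple product identity. -/
theorem prod_mul_prod_eq_sum_qBinom {R : Type*} [CommRing R] [IsDomain R] {q : R} (hq : q ≠ 0)
    (z : R) (n : ℕ) :
    (∏ i ∈ range n, (1 + z * q ^ i)) * ∏ i ∈ range n, (z + q ^ (i + 1)) =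
      ∑ k ∈ range (2 * n + 1), q ^ triInt (k - n) * z ^ k * qBinom q (2 * n) k := by
  -- In the `q`-binomial theorem with `2n` factors, `x = z`, `y = q^n`, the first `n` factors
  -- release `q^(n choose 2)` and the last `n` release `q^(n²)`.
  apply mul_left_cancel₀ (pow_ne_zero (n.choose 2 + n ^ 2) hq)
  have hprod := prod_add_mul_pow q z (q ^ n) (2 * n)
  have hlow : ∏ i ∈ range n, (q ^ n + z * q ^ i) =
      q ^ n.choose 2 * ∏ i ∈ range n, (z + q ^ (i + 1)) := by
    rw [← prod_range_reflect (fun i => z + q ^ (i + 1)) n, Nat.choose_two_right,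
      ← sum_range_id,
      ← prod_pow_eq_pow_sum, ← prod_mul_distrib]
    refine prod_congr rfl fun i hi => ?_
    have : n = i + (n - 1 - i + 1) := by have := mem_range.1 hi; omega
    nth_rewrite 1 [this]
    ring
  have hhigh : ∏ i ∈ range n, (q ^ n + z * q ^ (n + i)) =
      q ^ n ^ 2 * ∏ i ∈ range n, (1 + z * q ^ i) := by
    have hpow : q ^ n ^ 2 = ∏ _i ∈ range n, q ^ n := by rw [prod_const, card_range, sq, pow_mul]
    rw [hpow, ← prod_mul_distrib]
    exact prod_congr rfl fun i _ => by ring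
  rw [two_mul, prod_range_add, hlow, hhigh, ← two_mul] at hprod
  rw [mul_sum]
  calc _ = _ := by ring
    _ = _ := hprod
    _ = _ := sum_congr rfl fun k hk => ?_
  have hexp : k.choose 2 + n * (2 * n - k) = n.choose 2 + n ^ 2 + triInt (k - n) := by
    have h1 := two_mul_triInt (k - n)
    have hc (m : ℕ) : 2 * (m.choose 2 : ℤ) = m * (m - 1) := by
      induction m with
      | zero => simp
      | succ m ih =>
        rw [Nat.choose_succ_succ' m 1, Nat.choose_one_right]
        push_cast
        linarith
    have hk' : k ≤ 2 * n := by have := mem_range.1 hk; omega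
    zify [hk']
    have := hc k
    have := hc n
    linarith
  rw [← pow_mul]
  calc _ = q ^ (k.choose 2 + n * (2 * n - k)) * z ^ k * qBinom q (2 * n) k := by ring
    _ = _ := by rw [hexp]; ring

/-! ### Inverse Pochhammer series and Bailey's lemma. -/

/-- The geometric series `∑ X ^ (i * k)`, the inverse of `1 - X ^ i`. -/
noncomputable def geomSeries (i : ℕ) : ℤ⟦X⟧ := PowerSeries.mk fun m => if i ∣ m then 1 else 0

theorem one_sub_mul_geomSeries {i : ℕ} (hi : 0 < i) : (1 - X ^ i) * geomSeries i = 1 := by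
  ext m
  rw [sub_mul, one_mul, map_sub, coeff_X_pow_mul', coeff_one, geomSeries, coeff_mk]
  by_cases hm : i ≤ m
  · rw [if_pos hm, coeff_mk, if_neg (show m ≠ 0 by omega)]
    simp only [Nat.dvd_sub_iff_left hm dvd_rfl, sub_self]
  · rw [if_neg hm]
    rcases Nat.eq_zero_or_pos m with rfl | h0
    · simp
    · rw [if_neg (fun h => hm (Nat.le_of_dvd h0 h)), if_neg (by omega), sub_zero]

theorem isUnit_geomSeries {i : ℕ} (hi : 0 < i) : IsUnit (geomSeries i) :=
  IsUnit.of_mul_eq_one_right _ (one_sub_mul_geomSeries hi)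

/-- The inverse of the `q`-Pochhammer symbol `(X ^ b; X ^ b)_n`. -/
noncomputable def invPoch (b n : ℕ) : ℤ⟦X⟧ := ∏ i ∈ range n, geomSeries (b * (i + 1))

@[simp]
theorem invPoch_zero (b : ℕ) : invPoch b 0 = 1 := by simp [invPoch]

theorem isUnit_invPoch {b : ℕ} (hb : 0 < b) (n : ℕ) : IsUnit (invPoch b n) :=
  IsUnit.prod_iff.2 fun _ _ => isUnit_geomSeries (by positivity)

theorem one_sub_mul_invPoch {b : ℕ} (hb : 0 < b) (k : ℕ) :
    (1 - ((X : ℤ⟦X⟧) ^ b) ^ (k + 1)) * invPoch b (k + 1) = invPoch b k := by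
  have := one_sub_mul_geomSeries (i := b * (k + 1)) (by positivity)
  rw [invPoch, prod_range_succ, ← invPoch, ← pow_mul]
  linear_combination invPoch b k * this

theorem isUnit_one_sub_pow {b : ℕ} (hb : 0 < b) (k : ℕ) : IsUnit (1 - ((X : ℤ⟦X⟧) ^ b) ^ (k + 1)) := by
  rw [← pow_mul]
  exact IsUnit.of_mul_eq_one _ (one_sub_mul_geomSeries (by positivity))

theorem prod_mul_prod_mul_invPoch {b : ℕ} (hb : 0 < b) (z : ℤ⟦X⟧) (n : ℕ) :
    (∏ i ∈ range n, (1 + z * (X ^ b) ^ i)) * (∏ i ∈ range n, (z + (X ^ b) ^ (i + 1))) *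
        invPoch b (2 * n) =
      ∑ k ∈ range (2 * n + 1),
        (X ^ b) ^ triInt (k - n) * z ^ k * (invPoch b k * invPoch b (2 * n - k)) := by
  rw [prod_mul_prod_eq_sum_qBinom (pow_ne_zero _ X_ne_zero), sum_mul]
  refine sum_congr rfl fun k hk => ?_
  have h := qBinom_mul (invPoch_zero b) (one_sub_mul_invPoch hb) (isUnit_one_sub_pow hb) k
    (2 * n - k)
  rw [Nat.add_sub_cancel' (by have := mem_range.1 hk; omega)] at h
  rw [mul_assoc, h]

/-- `invPoch` extended by zero to negative indices. -/
noncomputable def invPochInt (b : ℕ) (r : ℤ) : ℤ⟦X⟧ := if 0 ≤ r then invPoch b r.toNat else 0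

@[simp]
theorem invPochInt_natCast (b n : ℕ) : invPochInt b n = invPoch b n := by simp [invPochInt]

theorem invPochInt_of_neg (b : ℕ) {r : ℤ} (hr : r < 0) : invPochInt b r = 0 := by
  simp [invPochInt, hr]

theorem sum_Icc_neg_eq_sum_range {M : Type*} [AddCommMonoid M] (n : ℕ) (g : ℤ → M) :
    ∑ r ∈ Icc (-n : ℤ) n, g r = ∑ k ∈ range (2 * n + 1), g (k - n) := by
  refine sum_nbij' (fun r => (r + n).toNat) (fun k => k - n) ?_ ?_ ?_ ?_ ?_
  · intro r hr; rw [mem_Icc] at hr; rw [mem_range]; omega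
  · intro k hk; rw [mem_range] at hk; rw [mem_Icc]; omega
  · intro r hr; rw [mem_Icc] at hr; omega
  · intro k hk; omega
  · intro r hr; rw [mem_Icc] at hr; congr 1; omega

theorem sum_Icc_invPochInt_mul (b n L : ℕ) (hn : n ≤ L) (g : ℤ → ℤ⟦X⟧) :
    ∑ r ∈ Icc (-L : ℤ) L, g r * (invPochInt b (n - r) * invPochInt b (n + r)) =
      ∑ k ∈ range (2 * n + 1), g (k - n) * (invPoch b k * invPoch b (2 * n - k)) := by
  have hsub : Icc (-n : ℤ) n ⊆ Icc (-L : ℤ) L := Icc_subset_Icc (by omega) (by omega)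
  rw [← sum_subset hsub]
  · rw [sum_Icc_neg_eq_sum_range n]
    refine sum_congr rfl fun k hk => ?_
    have hk' := mem_range.1 hk
    rw [show (n : ℤ) - (k - n) = ((2 * n - k : ℕ) : ℤ) by omega,
      show (n : ℤ) + (k - n) = (k : ℤ) by omega, invPochInt_natCast, invPochInt_natCast,
      mul_comm (invPoch b k)]
  · intro r _ hr
    rw [mem_Icc, not_and_or] at hr
    rcases hr with hr | hr
    · rw [invPochInt_of_neg b (show (n : ℤ) + r < 0 by omega)]; simp
    · rw [invPochInt_of_neg b (show (n : ℤ) - r < 0 by omega)]; simp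

/-- The Bailey step for a single `r`. With `a = |r|`, terms with `n < a` vanish; putting `n = a + m`
gives `n² = a² + m(m + 2a)`, so `sum_pow_mul_mul` applies with `s = L - a`, `d = 2a`. Both sides are
even in `r`. -/
theorem sum_pow_sq_mul_invPochInt {r : ℤ} {L : ℕ} (hr : r.natAbs ≤ L) :
    ∑ n ∈ range (L + 1),
        X ^ n ^ 2 * (invPoch 1 (L - n) * (invPochInt 1 (n - r) * invPochInt 1 (n + r))) =
      X ^ r.natAbs ^ 2 * (invPochInt 1 (L - r) * invPochInt 1 (L + r)) := by
  have main (a : ℕ) (ha : a ≤ L) : ∑ n ∈ range (L + 1),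
        X ^ n ^ 2 * (invPoch 1 (L - n) * (invPochInt 1 (n - a) * invPochInt 1 (n + a))) =
      X ^ a ^ 2 * (invPochInt 1 (L - a) * invPochInt 1 (L + a)) := by
    have hsplit : L + 1 = a + (L - a + 1) := by omega
    rw [hsplit, sum_range_add, sum_eq_zero, zero_add]
    · have h := sum_pow_mul_mul (invPoch_zero 1) (one_sub_mul_invPoch one_pos)
        (isUnit_one_sub_pow one_pos) (L - a) (2 * a)
      rw [show (L : ℤ) - a = ((L - a : ℕ) : ℤ) by omega,
        show (L : ℤ) + a = ((L - a + 2 * a : ℕ) : ℤ) by omega, invPochInt_natCast,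
        invPochInt_natCast, ← h, mul_sum]
      refine sum_congr rfl fun m _ => ?_
      rw [show ((a + m : ℕ) : ℤ) - a = m by push_cast; ring,
        show ((a + m : ℕ) : ℤ) + a = ((m + 2 * a : ℕ) : ℤ) by push_cast; ring,
        invPochInt_natCast, invPochInt_natCast, show L - (a + m) = L - a - m by omega]
      ring
    · intro n hn
      rw [invPochInt_of_neg 1 (show (n : ℤ) - a < 0 by have := mem_range.1 hn; omega)]
      simp
  rcases Int.natAbs_eq r with h | h
  · have := main _ hr
    rwa [← h] at this
  · have h' : (r.natAbs : ℤ) = -r := by omega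
    have := main _ hr
    rw [h'] at this
    simpa only [sub_neg_eq_add, ← sub_eq_add_neg, mul_comm (invPochInt 1 (_ + r))] using this

/-! ### Two finite sums over pentagonal numbers. -/

/-- The generalized pentagonal number `r (3 r - 1) / 2`. -/
def pentagonal (r : ℤ) : ℕ := triInt r + r.natAbs ^ 2

theorem three_mul_triInt_add (r : ℤ) : (3 * triInt r : ℤ) + r = pentagonal r := by
  have := two_mul_triInt r
  rw [pentagonal]
  push_cast
  rw [sq_abs]
  linarith

theorem natAbs_le_pentagonal (r : ℤ) : r.natAbs ≤ pentagonal r := by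
  rw [pentagonal]
  nlinarith [sq_nonneg ((r.natAbs : ℤ)), Nat.le_self_pow two_ne_zero r.natAbs]

/-- The series `(-1; X)_n (-X; X)_n / (X; X)_{2n}`. -/
noncomputable def baileyBeta (n : ℕ) : ℤ⟦X⟧ :=
  (∏ i ∈ range n, (1 + X ^ i)) * (∏ i ∈ range n, (1 + X ^ (i + 1))) * invPoch 1 (2 * n)

theorem sum_pow_sq_mul_baileyBeta (L : ℕ) :
    ∑ n ∈ range (L + 1), X ^ n ^ 2 * baileyBeta n * invPoch 1 (L - n) =
      ∑ r ∈ Icc (-L : ℤ) L, X ^ pentagonal r * (invPochInt 1 (L - r) * invPochInt 1 (L + r)) := by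
  have hbeta (n : ℕ) (hn : n ≤ L) : baileyBeta n =
      ∑ r ∈ Icc (-L : ℤ) L, X ^ triInt r * (invPochInt 1 (n - r) * invPochInt 1 (n + r)) := by
    rw [sum_Icc_invPochInt_mul 1 n L hn]
    simpa [baileyBeta] using prod_mul_prod_mul_invPoch one_pos 1 n
  calc _ = ∑ n ∈ range (L + 1), ∑ r ∈ Icc (-L : ℤ) L, X ^ triInt r *
        (X ^ n ^ 2 * (invPoch 1 (L - n) * (invPochInt 1 (n - r) * invPochInt 1 (n + r)))) := by
        refine sum_congr rfl fun n hn => ?_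
        rw [hbeta n (by have := mem_range.1 hn; omega), mul_sum, sum_mul]
        exact sum_congr rfl fun r _ => by ring
    _ = _ := by
        rw [sum_comm]
        refine sum_congr rfl fun r hr => ?_
        rw [mem_Icc] at hr
        rw [← mul_sum, sum_pow_sq_mul_invPochInt (by omega), pentagonal, pow_add]
        ring

theorem prod_mul_invPoch_three (n : ℕ) :
    (∏ i ∈ range n, (1 + X ^ (3 * i + 1))) * (∏ i ∈ range n, (1 + X ^ (3 * i + 2))) *
        invPoch 3 (2 * n) =
      ∑ r ∈ Icc (-n : ℤ) n, X ^ pentagonal r * (invPochInt 3 (n - r) * invPochInt 3 (n + r)) := by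
  rw [sum_Icc_invPochInt_mul 3 n n le_rfl]
  -- At `z = X` in base `X ^ 3`, each factor `z + X ^ (3(i+1))` contains one `X`, hence the extra `X
  -- ^ n`.
  apply mul_left_cancel₀ (pow_ne_zero n (X_ne_zero (R := ℤ)))
  have h := prod_mul_prod_mul_invPoch (b := 3) (by norm_num) X n
  have h1 : ∏ i ∈ range n, ((X : ℤ⟦X⟧) + (X ^ 3) ^ (i + 1)) =
      X ^ n * ∏ i ∈ range n, (1 + X ^ (3 * i + 2)) := by
    have hpow : (X : ℤ⟦X⟧) ^ n = ∏ _i ∈ range n, X := by rw [prod_const, card_range]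
    rw [hpow, ← prod_mul_distrib]
    exact prod_congr rfl fun i _ => by ring
  have h2 : ∏ i ∈ range n, (1 + (X : ℤ⟦X⟧) * (X ^ 3) ^ i) =
      ∏ i ∈ range n, (1 + X ^ (3 * i + 1)) :=
    prod_congr rfl fun i _ => by ring
  rw [h1, h2] at h
  calc _ = _ := by ring
    _ = _ := h
    _ = _ := by
      rw [mul_sum]
      refine sum_congr rfl fun k hk => ?_
      have hexp : 3 * triInt (k - n) + k = n + pentagonal (k - n) := by
        have := three_mul_triInt_add (k - n)
        omega
      rw [← pow_mul, ← pow_add, hexp, pow_add, mul_assoc]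

/-! ### Passing to the limit modulo `X ^ (M + 1)`. -/

/-- Reduction modulo `X ^ (M + 1)`. -/
noncomputable abbrev truncMod (M : ℕ) : ℤ⟦X⟧ →+* ℤ⟦X⟧ ⧸ Ideal.span {(X : ℤ⟦X⟧) ^ (M + 1)} :=
  Ideal.Quotient.mk _

theorem truncMod_X_pow_mul {M a : ℕ} (h : M < a) (f : ℤ⟦X⟧) : truncMod M (X ^ a * f) = 0 :=
  Ideal.Quotient.eq_zero_iff_mem.2
    (Ideal.mem_span_singleton.2 ((pow_dvd_pow X h).trans (dvd_mul_right _ _)))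

theorem coeff_eq_of_truncMod_eq {M : ℕ} {f g : ℤ⟦X⟧} (h : truncMod M f = truncMod M g) {N : ℕ}
    (hN : N ≤ M) : coeff N f = coeff N g := by
  rw [Ideal.Quotient.eq, Ideal.mem_span_singleton, X_pow_dvd_iff] at h
  have := h N (by omega)
  rwa [map_sub, sub_eq_zero] at this

/-- Raising the index from `l` to `l + 1` changes the series only by a multiple of `X ^ (a +
b(l+1))`, an exponent above `M`. -/
theorem truncMod_X_pow_mul_invPoch {b : ℕ} (hb : 0 < b) {M a k l : ℕ} (hk : M ≤ a + k)
    (hl : M ≤ a + l) :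
    truncMod M (X ^ a * invPoch b k) = truncMod M (X ^ a * invPoch b l) := by
  wlog hkl : k ≤ l generalizing k l
  · exact (this hl hk (by omega)).symm
  induction l, hkl using Nat.le_induction with
  | base => rfl
  | succ l hkl ih =>
    rw [ih (by omega), ← one_sub_mul_invPoch hb l, ← pow_mul]
    have hlt : M < a + b * (l + 1) := by nlinarith
    rw [← sub_eq_zero, ← map_sub, ← neg_eq_zero, ← map_neg]
    convert truncMod_X_pow_mul hlt (invPoch b (l + 1)) using 2
    ring

/-- The bound `|r| ≤ pentagonal r` makes up for the shift of the indices `M - r` and `M + r`, so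
both can be replaced by `M`. -/
theorem truncMod_sum_pentagonal {b : ℕ} (hb : 0 < b) (M : ℕ) :
    truncMod M (∑ r ∈ Icc (-M : ℤ) M,
        X ^ pentagonal r * (invPochInt b (M - r) * invPochInt b (M + r))) =
      truncMod M (∑ r ∈ Icc (-M : ℤ) M, X ^ pentagonal r) * truncMod M (invPoch b M) ^ 2 := by
  rw [map_sum, map_sum, sum_mul]
  refine sum_congr rfl fun r hr => ?_
  rw [mem_Icc] at hr
  have hp := natAbs_le_pentagonal r
  obtain ⟨k, hk⟩ := Int.eq_ofNat_of_zero_le (show 0 ≤ (M : ℤ) - r by omega)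
  obtain ⟨l, hl⟩ := Int.eq_ofNat_of_zero_le (show 0 ≤ (M : ℤ) + r by omega)
  rw [hk, hl, invPochInt_natCast, invPochInt_natCast]
  have h1 := truncMod_X_pow_mul_invPoch hb (M := M) (a := pentagonal r) (k := k) (l := M)
    (by omega) (by omega)
  have h2 := truncMod_X_pow_mul_invPoch hb (M := M) (a := pentagonal r) (k := l) (l := M)
    (by omega) (by omega)
  simp only [map_mul] at h1 h2 ⊢
  linear_combination truncMod M (invPoch b l) * h1 + truncMod M (invPoch b M) * h2

theorem invPoch_one_three_mul (M : ℕ) :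
    invPoch 1 (3 * M) =
      invPoch 3 M * ∏ i ∈ range M, (geomSeries (3 * i + 1) * geomSeries (3 * i + 2)) := by
  induction M with
  | zero => simp
  | succ M ih =>
    rw [show 3 * (M + 1) = 3 * M + 1 + 1 + 1 by ring, invPoch, prod_range_succ, prod_range_succ,
      prod_range_succ, ← invPoch, ih, prod_range_succ, invPoch, invPoch, prod_range_succ]
    simp only [one_mul, add_assoc, mul_add, mul_one, Nat.reduceAdd]
    ring

/-- The analytic identity behind the theorem, modulo `X ^ (M + 1)`. -/
theorem truncMod_sum_eq_prod (M : ℕ) :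
    truncMod M (∑ n ∈ range (M + 1), X ^ n ^ 2 * baileyBeta n) =
      truncMod M (∏ i ∈ range M, ((1 + X ^ (3 * i + 1)) * geomSeries (3 * i + 1) *
        ((1 + X ^ (3 * i + 2)) * geomSeries (3 * i + 2)))) := by
  set S := truncMod M (∑ r ∈ Icc (-M : ℤ) M, X ^ pentagonal r) with hS
  have u1 : IsUnit (truncMod M (invPoch 1 M)) := (isUnit_invPoch one_pos M).map _
  have u3 : IsUnit (truncMod M (invPoch 3 M)) := (isUnit_invPoch (by norm_num) M).map _
  have h1 : truncMod M (∑ n ∈ range (M + 1), X ^ n ^ 2 * baileyBeta n) =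
      S * truncMod M (invPoch 1 M) := by
    apply u1.mul_right_cancel
    rw [mul_assoc, ← sq, hS, ← truncMod_sum_pentagonal one_pos, ← sum_pow_sq_mul_baileyBeta,
      map_sum, map_sum, sum_mul]
    refine sum_congr rfl fun n hn => ?_
    have hn' := Nat.le_self_pow two_ne_zero n
    have h := truncMod_X_pow_mul_invPoch one_pos (M := M) (a := n ^ 2) (k := M) (l := M - n)
      (by omega) (by omega)
    simp only [map_mul] at h ⊢
    linear_combination truncMod M (baileyBeta n) * h
  have h3 : truncMod M ((∏ i ∈ range M, (1 + X ^ (3 * i + 1))) *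
      ∏ i ∈ range M, (1 + X ^ (3 * i + 2))) = S * truncMod M (invPoch 3 M) := by
    apply u3.mul_right_cancel
    rw [mul_assoc, ← sq, hS, ← truncMod_sum_pentagonal (by norm_num), ← prod_mul_invPoch_three,
      map_mul _ (_ * _)]
    have h := truncMod_X_pow_mul_invPoch (b := 3) (by norm_num) (M := M) (a := 0) (k := M)
      (l := 2 * M) (by omega) (by omega)
    rw [pow_zero, one_mul, one_mul] at h
    rw [h]
  -- The index `3 * M` allows the factors to be sorted by residue modulo 3.
  have h13 : truncMod M (invPoch 1 M) = truncMod M (invPoch 1 (3 * M)) := by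
    have h := truncMod_X_pow_mul_invPoch one_pos (M := M) (a := 0) (k := M)
      (l := 3 * M) (by omega) (by omega)
    rwa [pow_zero, one_mul, one_mul] at h
  rw [h1, h13, invPoch_one_three_mul, map_mul, ← mul_assoc, ← h3, ← map_mul]
  congr 1
  simp only [← prod_mul_distrib]
  exact prod_congr rfl fun i _ => by ring

/-! ### Partition generating functions with multiplicative weights. -/

/-- The series `∑ c k * X ^ (i * k)`. -/
noncomputable def partSeries (i : ℕ) (c : ℕ → ℤ) : ℤ⟦X⟧ :=
  PowerSeries.mk fun m => if i ∣ m then c (m / i) else 0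

/-- The partition in which `i` occurs `g i / i` times, for a function `g` with `i ∣ g i`. -/
theorem exists_partition_toFinsuppAntidiag_eq {s : Finset ℕ} (hs : 0 ∉ s) {N : ℕ} {g : ℕ →₀ ℕ}
    (hg : g ∈ s.finsuppAntidiag N) (hdvd : ∀ i ∈ s, i ∣ g i) :
    ∃ π : N.Partition, (∀ i ∈ π.parts, i ∈ s) ∧ π.toFinsuppAntidiag = g := by
  obtain ⟨hsum, hsupp⟩ := mem_finsuppAntidiag.1 hg
  have hmem {i : ℕ} (hi : i ∈ ∑ j ∈ s, Multiset.replicate (g j / j) j) : i ∈ s := by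
    obtain ⟨j, hj, hij⟩ := Multiset.mem_sum.1 hi
    rwa [Multiset.eq_of_mem_replicate hij]
  refine ⟨⟨∑ j ∈ s, Multiset.replicate (g j / j) j, fun {i} hi => ?_, ?_⟩, fun i hi => hmem hi, ?_⟩
  · exact Nat.pos_of_ne_zero fun h => hs (h ▸ hmem hi)
  · rw [← Multiset.coe_sumAddMonoidHom, map_sum, ← hsum]
    refine sum_congr rfl fun j hj => ?_
    rw [Multiset.coe_sumAddMonoidHom, Multiset.sum_replicate, smul_eq_mul,
      Nat.div_mul_cancel (hdvd j hj)]
  · ext i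
    change Multiset.count i (∑ j ∈ s, Multiset.replicate (g j / j) j) * i = g i
    rw [Multiset.count_sum']
    simp only [Multiset.count_replicate, sum_ite_eq']
    by_cases hi : i ∈ s
    · rw [if_pos hi, Nat.div_mul_cancel (hdvd i hi)]
    · rw [if_neg hi, zero_mul, Finsupp.notMem_support_iff.1 fun h => hi (hsupp h)]

/-- A finite product of series `partSeries i (w i)` enumerates partitions with parts in the index
set, weighted by the product of the `w i (f_i)`. -/
theorem coeff_prod_partSeries {s : Finset ℕ} (hs : 0 ∉ s) (w : ℕ → ℕ → ℤ) (N : ℕ) :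
    coeff N (∏ i ∈ s, partSeries i (w i)) =
      ∑ π : N.Partition, if ∀ i ∈ π.parts, i ∈ s then ∏ i ∈ s, w i (freq π i) else 0 := by
  rw [coeff_prod, ← sum_filter]
  refine (sum_of_injOn Nat.Partition.toFinsuppAntidiag
    (Nat.Partition.toFinsuppAntidiag_injective N).injOn ?_ ?_ ?_).symm
  · intro π hπ
    have hπ' : ∀ i ∈ π.parts, i ∈ s := by simpa using hπ
    have h := π.toFinsuppAntidiag_mem_finsuppAntidiag
    rw [mem_finsuppAntidiag'] at h
    rw [mem_coe, mem_finsuppAntidiag']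
    refine ⟨h.1, fun i hi => hπ' i ?_⟩
    rw [Finsupp.mem_support_iff] at hi
    change Multiset.count i π.parts * i ≠ 0 at hi
    exact Multiset.count_ne_zero.1 (left_ne_zero_of_mul hi)
  -- A nonzero product of coefficients forces `i ∣ g i` for every `i`, so `g` comes from a
  -- partition.
  · intro g hg hg'
    by_contra hne
    refine hg' ?_
    obtain ⟨π, hπ, rfl⟩ := exists_partition_toFinsuppAntidiag_eq hs hg fun i hi => by
      have := prod_ne_zero_iff.1 hne i hi
      rw [partSeries, coeff_mk] at this
      by_contra h
      exact this (if_neg h)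
    exact ⟨π, by simpa using hπ, rfl⟩
  · intro π _
    refine prod_congr rfl fun i hi => ?_
    have hi0 : 0 < i := Nat.pos_of_ne_zero fun h => hs (h ▸ hi)
    change _ = coeff (Multiset.count i π.parts * i) _
    rw [partSeries, coeff_mk, if_pos (dvd_mul_left _ _), Nat.mul_div_cancel _ hi0, freq]

theorem partSeries_add (i : ℕ) (c d : ℕ → ℤ) :
    partSeries i c + partSeries i d = partSeries i (c + d) := by
  ext m
  simp only [partSeries, map_add, coeff_mk, Pi.add_apply]
  split_ifs <;> simp

theorem geomSeries_eq_partSeries (i : ℕ) : geomSeries i = partSeries i fun _ => 1 := rfl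

theorem one_eq_partSeries {i : ℕ} (hi : 0 < i) :
    (1 : ℤ⟦X⟧) = partSeries i fun k => if k = 0 then 1 else 0 := by
  ext m
  rw [partSeries, coeff_one, coeff_mk]
  rcases Nat.eq_zero_or_pos m with rfl | hm
  · simp
  · rw [if_neg hm.ne']
    split_ifs with h1 h2
    · have := Nat.le_of_dvd hm h1
      rw [Nat.div_eq_zero_iff] at h2
      omega
    · rfl
    · rfl

theorem X_pow_mul_partSeries {i : ℕ} (hi : 0 < i) (c : ℕ → ℤ) :
    X ^ i * partSeries i c = partSeries i fun k => if k = 0 then 0 else c (k - 1) := by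
  ext m
  rw [coeff_X_pow_mul', partSeries, partSeries, coeff_mk, coeff_mk]
  by_cases hm : i ≤ m
  · rw [if_pos hm]
    have : m / i ≠ 0 := (Nat.div_pos hm hi).ne'
    simp only [Nat.dvd_sub_iff_left hm dvd_rfl, this, if_false]
    rw [show (m - i) / i = m / i - 1 from by simpa using Nat.sub_mul_div m i 1]
  · rw [if_neg hm, Nat.div_eq_of_lt (by omega)]
    simp

theorem geomSeries_sq {i : ℕ} (hi : 0 < i) :
    geomSeries i * geomSeries i = partSeries i fun k => k + 1 := by
  -- The recursion `f = geomSeries i + X ^ i * f` determines `f`, because `1 - X ^ i` is invertible.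
  have h : partSeries i (fun k => (k : ℤ) + 1) =
      geomSeries i + X ^ i * partSeries i (fun k => (k : ℤ) + 1) := by
    rw [X_pow_mul_partSeries hi, geomSeries_eq_partSeries, partSeries_add]
    congr 1
    funext k
    cases k <;> simp; ring
  linear_combination (-geomSeries i) * h +
    (partSeries i fun k => (k : ℤ) + 1) * one_sub_mul_geomSeries hi

theorem one_add_mul_geomSeries {i : ℕ} (hi : 0 < i) :
    (1 + X ^ i) * geomSeries i = partSeries i fun k => if k = 0 then 1 else 2 := by
  rw [add_mul, one_mul, geomSeries_eq_partSeries, X_pow_mul_partSeries hi, partSeries_add]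
  congr 1
  funext k
  cases k <;> simp

theorem one_add_mul_geomSeries_two_mul {i : ℕ} (hi : 0 < i) :
    (1 + X ^ i) * geomSeries (2 * i) = geomSeries i := by
  have h2 := one_sub_mul_geomSeries (i := 2 * i) (by omega)
  linear_combination geomSeries i * h2 -
    ((1 + X ^ i) * geomSeries (2 * i)) * one_sub_mul_geomSeries hi

/-! ### The class `setR`, sorted by `n`. -/

/-- The weight of the part `i` occurring `k` times in a partition of `setR` with `n(π) = n`. -/
def partWeight (n i k : ℕ) : ℤ :=
  if Even i then
    if i < n then if k = 0 then 0 else if k = 1 then 1 else 2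
    else if i = n then if k ≤ 1 then 0 else 2
    else if k = 1 then 1 else 0
  else if i < n then 2 * k + 1 else if i = n then 2 * k else 1

/-- Separating a factor depending on the parity of `i` from one depending on its position relative
to `n` lets the product over `i` be evaluated as two independent products. -/
theorem partSeries_partWeight {n i : ℕ} (hi : 0 < i) :
    partSeries i (partWeight n i) =
      (if Even i then X ^ i else geomSeries i) *
        (if i < n then (1 + X ^ i) * geomSeries i
          else if i = n then 2 * X ^ i * geomSeries i else 1) := by
  have hu := geomSeries_eq_partSeries i
  have hXu : X ^ i * geomSeries i = partSeries i fun k => if k = 0 then 0 else 1 :=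
    X_pow_mul_partSeries hi fun _ => 1
  by_cases he : Even i
  · rw [if_pos he]
    rcases lt_trichotomy i n with h | h | h
    · rw [if_pos h, one_add_mul_geomSeries hi, X_pow_mul_partSeries hi]
      congr 1
      funext k
      rcases k with _ | _ | k <;> simp [partWeight, he, h]
    · rw [if_neg (by omega), if_pos h,
        show X ^ i * (2 * X ^ i * geomSeries i) = X ^ i * (X ^ i * geomSeries i) +
          X ^ i * (X ^ i * geomSeries i) by ring, hXu, X_pow_mul_partSeries hi, partSeries_add]
      congr 1
      funext k
      rcases k with _ | _ | k <;> simp [partWeight, he, ← h]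
    · rw [if_neg (by omega), if_neg (by omega), one_eq_partSeries hi, X_pow_mul_partSeries hi]
      congr 1
      funext k
      rcases k with _ | _ | k <;>
        simp [partWeight, he, show ¬ i < n by omega, show ¬ i = n by omega]
  · rw [if_neg he]
    have hXuu : X ^ i * (geomSeries i * geomSeries i) = partSeries i fun k => k := by
      rw [geomSeries_sq hi, X_pow_mul_partSeries hi]
      congr 1
      funext k
      cases k <;> simp
    rcases lt_trichotomy i n with h | h | h
    · rw [if_pos h, show geomSeries i * ((1 + X ^ i) * geomSeries i) =
        geomSeries i * geomSeries i + X ^ i * (geomSeries i * geomSeries i) by ring, hXuu,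
        geomSeries_sq hi, partSeries_add]
      congr 1
      funext k
      simp only [partWeight, he, h, if_true, if_false, Pi.add_apply]
      ring
    · rw [if_neg (by omega), if_pos h, show geomSeries i * (2 * X ^ i * geomSeries i) =
        X ^ i * (geomSeries i * geomSeries i) + X ^ i * (geomSeries i * geomSeries i) by ring,
        hXuu, partSeries_add]
      congr 1
      funext k
      simp only [partWeight, he, if_false, Pi.add_apply, if_neg (show ¬ i < n by omega), if_pos h]
      ring
    · rw [if_neg (by omega), if_neg (by omega), mul_one, hu]
      congr 1
      funext k
      simp [partWeight, he, show ¬ i < n by omega, show ¬ i = n by omega]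

theorem prod_Ico_two_mul {M : Type*} [CommMonoid M] (f : ℕ → M) {n : ℕ} (hn : 1 ≤ n) :
    ∏ i ∈ Ico 1 (2 * n), f i =
      (∏ j ∈ Ico 1 n, f (2 * j)) * ∏ j ∈ range n, f (2 * j + 1) := by
  induction n, hn using Nat.le_induction with
  | base => simp
  | succ n hn ih =>
    rw [show 2 * (n + 1) = 2 * n + 1 + 1 by ring, prod_Ico_succ_top (by omega),
      prod_Ico_succ_top (by omega), ih, prod_Ico_succ_top hn, prod_range_succ]
    simp only [mul_assoc, mul_left_comm, mul_comm]

/-- Each even factor of `(X; X)_{2n}` splits as `1 - X ^ (2i) = (1 - X ^ i)(1 + X ^ i)`. -/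
theorem prod_one_add_mul_invPoch (n : ℕ) :
    (∏ i ∈ range n, (1 + X ^ (i + 1))) * invPoch 1 (2 * n) =
      (∏ i ∈ range n, geomSeries (i + 1)) * ∏ j ∈ range n, geomSeries (2 * j + 1) := by
  induction n with
  | zero => simp
  | succ n ih =>
    have h := one_add_mul_geomSeries_two_mul (Nat.succ_pos n)
    rw [Nat.succ_eq_add_one] at h
    rw [show 2 * (n + 1) = 2 * n + 1 + 1 by ring] at h ⊢
    rw [invPoch, prod_range_succ _ (2 * n + 1), prod_range_succ _ (2 * n), ← invPoch,
      prod_range_succ, prod_range_succ, prod_range_succ, one_mul, one_mul]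
    linear_combination geomSeries (2 * n + 1) * (1 + X ^ (n + 1)) * geomSeries (2 * n + 1 + 1) * ih +
      (∏ i ∈ range n, geomSeries (i + 1)) * (∏ j ∈ range n, geomSeries (2 * j + 1)) *
        geomSeries (2 * n + 1) * h

/-- The mandatory even parts give `X ^ (n(n-1))` and the part `n` gives `2 X ^ n`; that 2 is the `i
= 0` factor of `(-1; X)_n`. -/
theorem prod_partSeries_partWeight {n : ℕ} (hn : 1 ≤ n) :
    ∏ i ∈ Ico 1 (2 * n), partSeries i (partWeight n i) = X ^ n ^ 2 * baileyBeta n := by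
  have h1 : ∏ i ∈ Ico 1 (2 * n), (if Even i then (X : ℤ⟦X⟧) ^ i else geomSeries i) =
      X ^ (n * (n - 1)) * ∏ j ∈ range n, geomSeries (2 * j + 1) := by
    rw [prod_Ico_two_mul _ hn]
    congr 1
    · rw [← sum_range_id_mul_two, sum_mul, range_eq_Ico, sum_eq_sum_Ico_succ_bot hn, zero_mul,
        zero_add, ← prod_pow_eq_pow_sum]
      exact prod_congr rfl fun j _ => by rw [if_pos (even_two_mul j), mul_comm]
    · exact prod_congr rfl fun j _ => if_neg (by simp)
  have h2 : ∏ i ∈ Ico 1 (2 * n), (if i < n then (1 + (X : ℤ⟦X⟧) ^ i) * geomSeries i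
      else if i = n then 2 * X ^ i * geomSeries i else 1) =
      (∏ i ∈ Ico 1 n, (1 + X ^ i)) * (∏ i ∈ Ico 1 n, geomSeries i) *
        (2 * X ^ n * geomSeries n) := by
    rw [← prod_Ico_consecutive _ hn (show n ≤ 2 * n by omega), ← prod_mul_distrib,
      prod_eq_prod_Ico_succ_bot (show n < 2 * n by omega), if_neg (lt_irrefl n), if_pos rfl,
      prod_eq_one (s := Ico (n + 1) (2 * n)), mul_one]
    · congr 1
      exact prod_congr rfl fun i hi => if_pos (mem_Ico.1 hi).2
    · intro i hi
      have := (mem_Ico.1 hi).1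
      rw [if_neg (by omega), if_neg (by omega)]
  rw [prod_congr rfl fun i hi => partSeries_partWeight (mem_Ico.1 hi).1, prod_mul_distrib, h1, h2,
    baileyBeta, mul_assoc (∏ i ∈ range n, _), prod_one_add_mul_invPoch]
  obtain ⟨m, rfl⟩ : ∃ m, n = m + 1 := ⟨n - 1, by omega⟩
  simp only [prod_Ico_eq_prod_range, Nat.add_sub_cancel, add_comm 1]
  rw [prod_range_succ' (fun i => 1 + (X : ℤ⟦X⟧) ^ i) m, prod_range_succ (fun i => geomSeries (i + 1))]
  ring

/-- The conditions defining `setR` for a given `n`. -/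
def IsRWith (n : ℕ) {N : ℕ} (π : N.Partition) : Prop :=
  0 < n ∧
    (∀ i ∈ π.parts, i + 1 ≤ 2 * n) ∧
    (∀ i : ℕ, 0 < i → Even i → i + 2 ≤ 2 * n → i ∈ π.parts) ∧
    1 + (if Even n then 1 else 0) ≤ freq π n ∧
    (∀ i ∈ π.parts, Even i → n < i → freq π i = 1)

theorem IsRWith.nStat_eq {n N : ℕ} {π : N.Partition} (h : IsRWith n π) : nStat π = n := by
  obtain ⟨hn, hle, heven, -, -⟩ := h
  have hsup : (π.parts.filter Even).sup = 2 * n - 2 := by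
    apply le_antisymm
    · refine Multiset.sup_le.2 fun i hi => ?_
      rw [Multiset.mem_filter] at hi
      have h1 := hle i hi.1
      obtain ⟨j, hj⟩ := hi.2
      omega
    · rcases Nat.lt_or_ge n 2 with h2 | h2
      · have : 2 * n - 2 = 0 := by omega
        rw [this]
        exact Nat.zero_le _
      · have he : Even (2 * n - 2) := ⟨n - 1, by omega⟩
        exact Multiset.le_sup (Multiset.mem_filter.2 ⟨heven _ (by omega) he (by omega), he⟩)
  rw [nStat, hsup]
  omega

theorem IsRWith.le {n N : ℕ} {π : N.Partition} (h : IsRWith n π) : n ≤ N := by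
  obtain ⟨-, -, -, hf, -⟩ := h
  refine Nat.Partition.le_of_mem_parts (p := π) (Multiset.count_pos.1 ?_)
  rw [freq] at hf
  omega

theorem IsRWith.prod_partWeight_even {n N : ℕ} {π : N.Partition} (h : IsRWith n π) :
    ∏ j ∈ Ico 1 n, partWeight n (2 * j) (freq π (2 * j)) = 2 ^ delta π := by
  rw [delta, h.nStat_eq, ← prod_pow_eq_pow_sum]
  obtain ⟨-, -, heven, hf, hone⟩ := h
  refine prod_congr rfl fun j hj => ?_
  rw [mem_Ico] at hj
  have hmem : 2 * j ∈ π.parts := heven _ (by omega) (even_two_mul j) (by omega)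
  have hpos : 0 < freq π (2 * j) := Multiset.count_pos.2 hmem
  rw [partWeight, if_pos (even_two_mul j)]
  rcases lt_trichotomy (2 * j) n with h | h | h
  · rw [if_pos h, if_neg hpos.ne']
    by_cases h1 : freq π (2 * j) = 1
    · simp [h1]
    · rw [if_neg h1, if_pos (by omega), pow_one]
  -- For even `n`, the condition `f_n ≥ 2` makes `j = n / 2` always count in `delta`.
  · rw [← h, if_pos (even_two_mul j)] at hf
    rw [if_neg (by omega), if_pos h, if_neg (by omega), if_pos (by omega), pow_one]
  · rw [if_neg (by omega), if_neg (by omega), hone _ hmem (even_two_mul j) h]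
    simp

theorem IsRWith.prod_partWeight_odd {n N : ℕ} {π : N.Partition} (h : IsRWith n π) :
    ∏ j ∈ range n, partWeight n (2 * j + 1) (freq π (2 * j + 1)) = gamma π := by
  have hw (j : ℕ) : partWeight n (2 * j + 1) (freq π (2 * j + 1)) =
      (if 2 * j + 1 = n then 2 * (freq π n : ℤ) else 1) *
        (if 2 * j + 1 < n then 2 * (freq π (2 * j + 1) : ℤ) + 1 else 1) := by
    rw [partWeight, if_neg (by simp)]
    rcases lt_trichotomy (2 * j + 1) n with h | h | h
    · rw [if_pos h, if_pos h, if_neg (by omega), one_mul]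
    · rw [if_neg h.not_lt, if_neg h.not_lt, if_pos h, if_pos h, h, mul_one]
    · rw [if_neg (by omega), if_neg (by omega), if_neg (by omega), if_neg (by omega), one_mul]
  rw [prod_congr rfl fun j _ => hw j, prod_mul_distrib, gamma, h.nStat_eq, prod_filter]
  push_cast
  congr 1
  rcases Nat.even_or_odd n with he | ho
  · rw [if_pos he, if_neg (Nat.not_odd_iff_even.2 he), prod_eq_one]
    · simp
    · intro j _
      obtain ⟨m, rfl⟩ := he
      exact if_neg (by omega)
  · rw [if_neg (Nat.not_even_iff_odd.2 ho), if_pos ho]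
    obtain ⟨m, hm⟩ := ho
    rw [prod_eq_single m]
    · rw [if_pos hm.symm]
      ring
    · intro j _ hj
      exact if_neg (by omega)
    · intro hm'
      exact absurd (mem_range.2 (by omega)) hm'

theorem IsRWith.prod_partWeight {n N : ℕ} {π : N.Partition} (h : IsRWith n π) :
    ∏ i ∈ Ico 1 (2 * n), partWeight n i (freq π i) = mu π := by
  rw [prod_Ico_two_mul _ h.1, h.prod_partWeight_even, h.prod_partWeight_odd, mu]
  push_cast
  rfl

theorem isRWith_of_prod_ne_zero {n N : ℕ} {π : N.Partition} (hn : 1 ≤ n)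
    (hparts : ∀ i ∈ π.parts, i ∈ Ico 1 (2 * n))
    (hprod : ∏ i ∈ Ico 1 (2 * n), partWeight n i (freq π i) ≠ 0) : IsRWith n π := by
  rw [prod_ne_zero_iff] at hprod
  refine ⟨hn, fun i hi => (mem_Ico.1 (hparts i hi)).2, fun i hi he hin => ?_, ?_, ?_⟩
  · by_contra hmem
    apply hprod i (mem_Ico.2 (by omega))
    rw [show freq π i = 0 from Multiset.count_eq_zero.2 hmem]
    simp [partWeight, he]
  · have h := hprod n (mem_Ico.2 (by omega))
    rw [partWeight, if_neg (lt_irrefl n), if_pos rfl] at h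
    by_cases he : Even n
    · rw [if_pos he] at h ⊢
      by_contra hlt
      exact h (if_pos (by omega))
    · rw [if_neg he, if_neg (lt_irrefl n), if_pos rfl] at h
      rw [if_neg he]
      have : freq π n ≠ 0 := fun h0 => h (by rw [h0]; simp)
      omega
  · intro i hi he hni
    have h := hprod i (hparts i hi)
    rw [partWeight, if_pos he, if_neg (by omega), if_neg (by omega)] at h
    by_contra h1
    exact h (if_neg h1)

-- Weights vanish off `setR`, and `nStat` fixes `n`, so at most one term survives; it lies in range
-- because `n` is itself a part.
open Classical in
theorem sum_prod_partWeight {N M : ℕ} (hNM : N ≤ M) (π : N.Partition) :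
    (∑ n ∈ Ico 1 (M + 1), if ∀ i ∈ π.parts, i ∈ Ico 1 (2 * n) then
        ∏ i ∈ Ico 1 (2 * n), partWeight n i (freq π i) else 0) =
      if (⟨N, π⟩ : Σ N : ℕ, N.Partition) ∈ setR then (mu π : ℤ) else 0 := by
  have hzero (n : ℕ) (hn : 1 ≤ n) (hR : ¬ IsRWith n π) :
      (if ∀ i ∈ π.parts, i ∈ Ico 1 (2 * n) then
        ∏ i ∈ Ico 1 (2 * n), partWeight n i (freq π i) else 0) = 0 := by
    split_ifs with hparts
    · by_contra h
      exact hR (isRWith_of_prod_ne_zero hn hparts h)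
    · rfl
  by_cases h : (⟨N, π⟩ : Σ N : ℕ, N.Partition) ∈ setR
  · rw [if_pos h]
    obtain ⟨n, hn⟩ := h
    change IsRWith n π at hn
    rw [sum_eq_single_of_mem n (mem_Ico.2 ⟨hn.1, by have := hn.le; omega⟩), if_pos,
      hn.prod_partWeight]
    · exact fun i hi => mem_Ico.2 ⟨π.parts_pos hi, hn.2.1 i hi⟩
    · intro m hm hmn
      exact hzero m (mem_Ico.1 hm).1 fun hR => hmn (hR.nStat_eq.symm.trans hn.nStat_eq)
  · rw [if_neg h]
    exact sum_eq_zero fun n hn => hzero n (mem_Ico.1 hn).1 fun hR => h ⟨n, hR⟩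

theorem coeff_genFun_setR {N M : ℕ} (hNM : N ≤ M) :
    coeff N (genFun setR fun p => mu p.2) =
      coeff N (∑ n ∈ Ico 1 (M + 1), X ^ n ^ 2 * baileyBeta n) := by
  rw [map_sum, genFun, coeff_mk]
  simp only [← sum_prod_partWeight hNM]
  rw [sum_comm]
  refine sum_congr rfl fun n hn => ?_
  rw [← prod_partSeries_partWeight (mem_Ico.1 hn).1, coeff_prod_partSeries (by simp)]

/-! ### The class `setC` and the conclusion. -/

theorem prod_range_filter_not_three_dvd {M : Type*} [CommMonoid M] (f : ℕ → M) (m : ℕ) :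
    ∏ i ∈ range (3 * m + 1) with ¬ 3 ∣ i, f i =
      ∏ i ∈ range m, (f (3 * i + 1) * f (3 * i + 2)) := by
  rw [prod_filter]
  induction m with
  | zero => simp
  | succ m ih =>
    rw [show 3 * (m + 1) + 1 = 3 * m + 1 + 1 + 1 + 1 by ring, prod_range_succ, prod_range_succ,
      prod_range_succ, ih, prod_range_succ, if_pos (by omega), if_pos (by omega),
      if_neg (by omega), mul_one, mul_assoc]

/-- The weight is multiplicative, 2 for each part size present and 1 for each absent; the `- 1`
discards the empty partition. -/
theorem coeff_genFun_setC {N M : ℕ} (hNM : N ≤ M) :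
    coeff N (genFun setC fun p => 2 ^ numDistinctParts p.2) =
      coeff N (∏ i ∈ range M, ((1 + X ^ (3 * i + 1)) * geomSeries (3 * i + 1) *
        ((1 + X ^ (3 * i + 2)) * geomSeries (3 * i + 2))) - 1) := by
  have hprod : ∏ i ∈ range M, ((1 + X ^ (3 * i + 1)) * geomSeries (3 * i + 1) *
        ((1 + X ^ (3 * i + 2)) * geomSeries (3 * i + 2))) =
      ∏ i ∈ range (3 * M + 1) with ¬ 3 ∣ i, partSeries i fun k => if k = 0 then 1 else 2 := by
    rw [← prod_range_filter_not_three_dvd fun i => (1 + X ^ i) * geomSeries i]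
    refine prod_congr rfl fun i hi => one_add_mul_geomSeries (Nat.pos_of_ne_zero ?_)
    rintro rfl
    simp at hi
  have hmem (π : N.Partition) :
      (∀ i ∈ π.parts, i ∈ (range (3 * M + 1)).filter fun i => ¬ 3 ∣ i) ↔
        ∀ i ∈ π.parts, ¬ 3 ∣ i := by
    refine forall₂_congr fun i hi => ?_
    have := Nat.Partition.le_of_mem_parts hi
    rw [mem_filter, mem_range]
    exact and_iff_right (by omega)
  have hweight (π : N.Partition) (h : ∀ i ∈ π.parts, ¬ 3 ∣ i) :
      ∏ i ∈ range (3 * M + 1) with ¬ 3 ∣ i, (if freq π i = 0 then (1 : ℤ) else 2) =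
        2 ^ numDistinctParts π := by
    rw [numDistinctParts, ← prod_const]
    symm
    refine prod_subset_one_on_sdiff (fun i hi => (hmem π).2 h i (Multiset.mem_toFinset.1 hi)) ?_ ?_
    · intro i hi
      rw [mem_sdiff, Multiset.mem_toFinset] at hi
      exact if_pos (Multiset.count_eq_zero.2 hi.2)
    · intro i hi
      exact (if_neg (Multiset.count_ne_zero.2 (Multiset.mem_toFinset.1 hi))).symm
  have hparts (π : N.Partition) : π.parts = 0 ↔ N = 0 := by
    constructor
    · intro h
      rw [← π.parts_sum, h, Multiset.sum_zero]
    · rintro rfl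
      exact Nat.Partition.partition_zero_parts π
  rw [map_sub, hprod, coeff_prod_partSeries (by simp), genFun, coeff_mk]
  simp only [hmem]
  rcases Nat.eq_zero_or_pos N with rfl | hN
  · simp [setC, freq]
  · rw [coeff_one, if_neg hN.ne', sub_zero]
    refine sum_congr rfl fun π _ => ?_
    have hne : π.parts ≠ 0 := fun h => hN.ne' ((hparts π).1 h)
    by_cases h : ∀ i ∈ π.parts, ¬ 3 ∣ i
    · rw [if_pos h, if_pos ⟨hne, h⟩, hweight π h]
      push_cast
      rfl
    · rw [if_neg h, if_neg fun hC => h hC.2]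

end WeightedPartitions

open WeightedPartitions in
theorem mainTheorem11 :
    WeightedPartitions.genFun WeightedPartitions.setC
        (fun p => 2 ^ WeightedPartitions.numDistinctParts p.2) =
      WeightedPartitions.genFun WeightedPartitions.setR
        (fun p => WeightedPartitions.mu p.2) := by
  ext N
  rw [coeff_genFun_setC le_rfl, coeff_genFun_setR le_rfl]
  refine coeff_eq_of_truncMod_eq (M := N) ?_ le_rfl
  -- The term `n = 0` equals 1 and cancels the contribution of the empty partition.
  rw [map_sub, ← truncMod_sum_eq_prod, ← map_sub, range_eq_Ico,
    sum_eq_sum_Ico_succ_bot (Nat.succ_pos N)]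
  congr 1
  simp [baileyBeta]
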